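/- Let $f$ be a probability measure on $\mathbb{R}$ with $\int v^2 f(dv)=E$ and $\int |v|^r f(dv)<\infty$ for some $r>2$. For $N\ge 1$ let $S^{N-1}(\sqrt{NE})=\{v\in\mathbb{R}^N:\sum_i v_i^2=NE\}$, let $X=(X_1,\dots,X_N)$ have law $f^{\otimes N}$, let $Z$ be an exchangeable random vector with values in $S^{N-1}(\sqrt{NE})$, independent of $X$ (its law is otherwise arbitrary), and let $f^N$ be the law of $Y=(Y_1,\dots,Y_N)$, where $$Y_i=\Big(\frac{E}{\frac1N\sum_j X_j^2}\Big)^{1/2}X_i \quad\text{on } \Big\{\sum_j X_j^2>0\Big\},\qquad Y=Z\quad\text{on }\Big\{\sum_j X_j^2=0\Big\}.$$ For probability measures $\nu,\tilde\nu$ on $\mathbb{R}^k$ let $W_2(\nu,\tilde\nu)^2=\inf \mathbb{E}\big[\frac1k\sum_{i=1}^k|U_i-V_i|^2\big]$, the infimum being over all couplings $(U,V)$ of $\nu$ and $\tilde\nu$, and let $\varepsilon_N(f)=\mathbb{E}\big[W_2(\bar X,f)^2\big]$, where $\bar X=\frac1N\sum_{i=1}^N\delta_{X_i}$. Then $(f^N)_{N\ge1}$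 is a sequence of distributions supported on the spheres $S^{N-1}(\sqrt{NE})$ which is chaotic to $f$: each $f^N$ is symmetric, and for every fixed $k$ the marginal of $f^N$ in the first $k$ variables converges weakly to $f^{\otimes k}$ as $N\to\infty$. Moreover, for all $N\ge1$, $$W_2(f^N,f^{\otimes N})^2\le\varepsilon_N(f).$$ Furthermore, there exists a constant $C$ depending only on $r$ and $\int|v|^r f(dv)$ such that $$W_2(f^N,f^{\otimes N})^2\le C\begin{cases}N^{-1/2}, & r>4,\ N\ge 1,\\ N^{-1/2}\log N, & r=4,\ N\ge2,\\ N^{-(1-2/r)}, & r\in(2,4),\ N\ge 1.\end{cases}$$ -/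

import Mathlib

open MeasureTheory Filter Topology
open scoped ENNReal

/-- The sphere `S^{N-1}(√(N E)) = {v ∈ ℝ^N : ∑ v_i² = N E}`. -/
def kacSphere (N : ℕ) (E : ℝ) : Set (Fin N → ℝ) :=
  {v | ∑ i, v i ^ 2 = N * E}

/-- The tensor power `f^{⊗N}`. -/
noncomputable def tensorPower (f : ProbabilityMeasure ℝ) (N : ℕ) :
    ProbabilityMeasure (Fin N → ℝ) :=
  ⟨Measure.pi fun _ => (f : Measure ℝ), inferInstance⟩

/-- A law on `ℝ^N` is symmetric (its random vectors are exchangeable) if it is invariant under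
all permutations of the coordinates. -/
def IsSymmetricLaw {N : ℕ} (μ : ProbabilityMeasure (Fin N → ℝ)) : Prop :=
  ∀ σ : Equiv.Perm (Fin N),
    (μ : Measure (Fin N → ℝ)).map (fun x i => x (σ i)) = μ

/-- Rescaling of `x` to the sphere; `z` is used when `∑ x_j² = 0`. -/
noncomputable def rescale {N : ℕ} (E : ℝ) (x z : Fin N → ℝ) : Fin N → ℝ :=
  if 0 < ∑ j, x j ^ 2 then fun i => √(E / ((1 / N) * ∑ j, x j ^ 2)) * x i else z

theorem measurable_rescale {N : ℕ} (E : ℝ) :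
    Measurable fun p : (Fin N → ℝ) × (Fin N → ℝ) => rescale E p.1 p.2 := by
  unfold rescale
  refine Measurable.ite (measurableSet_lt measurable_const ?_) ?_ measurable_snd
  · fun_prop
  · fun_prop

/-- The law `f^N` of `Y`, where `X ∼ f^{⊗N}` and `Z ∼ ζ` are independent, `Y` is the rescaling
of `X` on the event `∑ X_j² > 0`, and `Y = Z` on the event `∑ X_j² = 0`. -/
noncomputable def rescaledLaw (f : ProbabilityMeasure ℝ) (E : ℝ) {N : ℕ}
    (ζ : ProbabilityMeasure (Fin N → ℝ)) : ProbabilityMeasure (Fin N → ℝ) :=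
  ((tensorPower f N).prod ζ).map (f := fun p => rescale E p.1 p.2)
    (measurable_rescale E).aemeasurable

/-- The marginal law of the first `k` coordinates. -/
noncomputable def firstMarginal (k m : ℕ) (μ : ProbabilityMeasure (Fin (k + m) → ℝ)) :
    ProbabilityMeasure (Fin k → ℝ) :=
  μ.map (f := fun x i => x (Fin.castAdd m i))
    (measurable_pi_lambda _ fun i => measurable_pi_apply (Fin.castAdd m i)).aemeasurable

/-- A sequence of symmetric laws `F N` on `ℝ^N` is `f`-chaotic if for every fixed `k` the marginal
of `F N` in the first `k` variables converges weakly to `f^{⊗k}` as `N → ∞`. Here `N = k + m`, and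
weak convergence is convergence in the topology of `ProbabilityMeasure`. -/
def IsChaotic (F : ∀ N : ℕ, ProbabilityMeasure (Fin N → ℝ)) (f : ProbabilityMeasure ℝ) : Prop :=
  (∀ N, IsSymmetricLaw (F N)) ∧
    ∀ k : ℕ, Tendsto (fun m => firstMarginal k m (F (k + m))) atTop (𝓝 (tensorPower f k))

/-- `γ` is a coupling of `μ` and `ν`: the joint law of a pair with marginal laws `μ` and `ν`. -/
def IsCouplingOf {α : Type*} [MeasurableSpace α] (γ : Measure (α × α)) (μ ν : Measure α) : Prop :=
  γ.map Prod.fst = μ ∧ γ.map Prod.snd = ν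

/-- The `2`-Wasserstein distance on `ℝ^k`, with the normalizing factor `1/k`. -/
noncomputable def W2 {k : ℕ} (μ ν : Measure (Fin k → ℝ)) : ℝ≥0∞ :=
  (⨅ (γ : Measure ((Fin k → ℝ) × (Fin k → ℝ))) (_ : IsCouplingOf γ μ ν),
    ∫⁻ p, ENNReal.ofReal ((1 / k) * ∑ i, |p.1 i - p.2 i| ^ 2) ∂γ) ^ (1 / 2 : ℝ)

/-- The `2`-Wasserstein distance on `ℝ` (the case `k = 1`, with `ℝ^1` identified with `ℝ`). -/
noncomputable def W2Line (μ ν : Measure ℝ) : ℝ≥0∞ :=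
  (⨅ (γ : Measure (ℝ × ℝ)) (_ : IsCouplingOf γ μ ν),
    ∫⁻ p, ENNReal.ofReal (|p.1 - p.2| ^ 2) ∂γ) ^ (1 / 2 : ℝ)

/-- The empirical measure `(1/N) ∑ δ_{x_i}`. -/
noncomputable def empiricalMeasure {N : ℕ} (x : Fin N → ℝ) : Measure ℝ :=
  (N : ℝ≥0∞)⁻¹ • ∑ i, Measure.dirac (x i)

/-- `ε_N(f) = 𝔼 W₂(X̄, f)²` for `X ∼ f^{⊗N}` with empirical measure `X̄`. -/
noncomputable def epsilonN (N : ℕ) (f : ProbabilityMeasure ℝ) : ℝ≥0∞ :=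
  ∫⁻ x, W2Line (empiricalMeasure x) f ^ 2 ∂(tensorPower f N : Measure (Fin N → ℝ))

/-! Write `Q = (1/N) ∑ X_j²`. Coupling `Y` with the sample `X` it is built from costs exactly `(√E -
√Q)²`: `Y` is `X` scaled to norm `√(NE)`, and when `X = 0` any point of the sphere is equally far
from it. Hence `W₂(f^N, f^{⊗N})² ≤ 𝔼 (√E - √Q)²` (`W2_rescaledLaw_sq_le`), and everything follows
from estimates of this expectation.

Since `√Q` and `√E` are the `L²` norms of the marginals of any coupling of `X̄` and `f`, Minkowski's
inequality bounds the integrand by `W₂(X̄, f)²` (`ofReal_sq_sqrt_sub_le_W2Line_sq`), which gives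
`ε_N(f)`.

For the rates, `(√E - √Q)² ≤ |Q - E|`, and a truncated law of large numbers with `s = min r 4`
moments yields `𝔼 |Q - E| = O(N^{-(1-2/s)})` (`integral_abs_avg_sq_sub_le`).

For chaos, exchangeability spreads the cost equally over the coordinates, so the first `k`
coordinates of `Y` and `X` merge in `L²`. -/

open ProbabilityTheory in
theorem integral_abs_le_sqrt_integral_sq {Ω : Type*} [MeasurableSpace Ω] {μ : Measure Ω}
    [IsProbabilityMeasure μ] {g : Ω → ℝ} (hg : MemLp g 2 μ) :
    ∫ x, |g x| ∂μ ≤ √(∫ x, g x ^ 2 ∂μ) := by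
  apply Real.le_sqrt_of_sq_le
  have h := variance_nonneg (fun x => |g x|) μ
  rw [variance_eq_sub (X := fun x => |g x|) hg.abs] at h
  simpa [sq_abs] using h

/-! ### Law of large numbers in `L¹` for averages of squares -/

section Average

variable {N : ℕ} {ν : Measure ℝ} [IsProbabilityMeasure ν]

theorem integrable_avg {b : ℝ → ℝ} (hb : Integrable b ν) :
    Integrable (fun x : Fin N → ℝ => 1 / N * ∑ j, b (x j)) (Measure.pi fun _ => ν) :=
  (integrable_finsetSum _ fun _ _ => integrable_comp_eval (μ := fun _ : Fin N => ν) hb).const_mul _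

theorem integral_avg (hN : 1 ≤ N) {b : ℝ → ℝ} (hb : Integrable b ν) :
    ∫ x : Fin N → ℝ, 1 / N * ∑ j, b (x j) ∂(Measure.pi fun _ => ν) = ∫ v, b v ∂ν := by
  have hN' : (N : ℝ) ≠ 0 := by positivity
  rw [integral_const_mul, integral_finsetSum _
    fun j _ => integrable_comp_eval (μ := fun _ : Fin N => ν) hb]
  simp only [integral_comp_eval (μ := fun _ : Fin N => ν) hb.aestronglyMeasurable]
  simp [hN']

/-- Triangle inequality only: this serves the tail part of the truncation, where no second moment is
available. -/
theorem integral_abs_avg_sub_le {b : ℝ → ℝ} (hN : 1 ≤ N) (hb : Integrable b ν)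
    (hb0 : ∀ v, 0 ≤ b v) :
    ∫ x : Fin N → ℝ, |1 / N * ∑ j, b (x j) - ∫ v, b v ∂ν| ∂(Measure.pi fun _ => ν)
      ≤ 2 * ∫ v, b v ∂ν := by
  have hI : 0 ≤ ∫ v, b v ∂ν := integral_nonneg hb0
  calc _ ≤ ∫ x : Fin N → ℝ, (1 / N * ∑ j, b (x j) + ∫ v, b v ∂ν) ∂(Measure.pi fun _ => ν) := by
        refine integral_mono ((integrable_avg hb).sub (integrable_const _)).abs
          ((integrable_avg hb).add (integrable_const _)) fun x => ?_
        have h0 : 0 ≤ 1 / (N : ℝ) * ∑ j, b (x j) :=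
          mul_nonneg (by positivity) (Finset.sum_nonneg fun j _ => hb0 _)
        exact abs_le.2 ⟨by linarith, by linarith⟩
    _ = _ := by
        rw [integral_add (integrable_avg hb) (integrable_const _), integral_avg hN hb]
        simp
        ring

-- Independence divides the variance by `N`, and the `L¹` norm is at most the `L²` norm.
open ProbabilityTheory in
theorem integral_abs_avg_sub_le_sqrt {a : ℝ → ℝ} (hN : 1 ≤ N) (ha : MemLp a 2 ν) :
    ∫ x : Fin N → ℝ, |1 / N * ∑ j, a (x j) - ∫ v, a v ∂ν| ∂(Measure.pi fun _ => ν)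
      ≤ √((∫ v, a v ^ 2 ∂ν) / N) := by
  have ha1 : Integrable a ν := ha.integrable (by norm_num)
  have hW : MemLp (fun x : Fin N → ℝ => 1 / N * ∑ j, a (x j)) 2 (Measure.pi fun _ => ν) :=
    (memLp_finsetSum _ fun j _ =>
      ha.comp_measurePreserving (measurePreserving_eval (fun _ : Fin N => ν) j)).const_mul _
  refine (integral_abs_le_sqrt_integral_sq (hW.sub (memLp_const _))).trans ?_
  apply Real.sqrt_le_sqrt
  have hv : Var[fun x : Fin N → ℝ => 1 / N * ∑ j, a (x j); Measure.pi fun _ => ν]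
      = 1 / N * Var[a; ν] := by
    have h := variance_sum_pi (μ := fun _ : Fin N => ν) (X := fun _ => a) fun _ => ha
    have hs : (∑ i : Fin N, fun ω : Fin N → ℝ => a (ω i)) = fun ω => ∑ i, a (ω i) := by
      ext; simp
    rw [hs] at h
    rw [variance_const_mul, h]
    have hN' : (N : ℝ) ≠ 0 := by positivity
    simp
    field_simp
  rw [variance_eq_integral hW.aestronglyMeasurable.aemeasurable, integral_avg hN ha1] at hv
  simp only [Pi.sub_apply]
  rw [hv]
  have := variance_le_expectation_sq ha.aestronglyMeasurable
  simp only [Pi.pow_apply] at this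
  rw [one_div, inv_mul_eq_div]
  gcongr

/-- The `L¹` law of large numbers for squares, with a rate, under a moment of order `s ≤ 4`. -/
theorem integral_abs_avg_sq_sub_le {s K : ℝ} (hs : 2 < s) (hs4 : s ≤ 4) (hN : 1 ≤ N)
    (hint : Integrable (fun v : ℝ => |v| ^ s) ν) (hK : ∫ v, |v| ^ s ∂ν ≤ K) :
    Integrable (fun v : ℝ => v ^ 2) ν ∧
    ∫ x : Fin N → ℝ, |1 / N * ∑ j, x j ^ 2 - ∫ v, v ^ 2 ∂ν| ∂(Measure.pi fun _ => ν)
      ≤ (√K + 2 * K) * (N : ℝ) ^ (-(1 - 2 / s)) := by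
  have hN0 : (0 : ℝ) < N := by positivity
  have hs0 : 0 < s := by linarith
  have hK0 : 0 ≤ K := (integral_nonneg fun v => by positivity).trans hK
  -- This cutoff balances the errors: the fluctuation `√(S^(4-s) / N)` of the truncated part and the
  -- tail `S^(2-s)` both equal `N^(-(1-2/s))`.
  set S : ℝ := (N : ℝ) ^ (1 / s) with hS
  have hS0 : 0 < S := by positivity
  set A : Set ℝ := {v | |v| ≤ S} with hA
  have hAm : MeasurableSet A := measurableSet_le (by fun_prop) measurable_const
  set a : ℝ → ℝ := A.indicator fun v => v ^ 2 with ha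
  set b : ℝ → ℝ := Aᶜ.indicator fun v => v ^ 2 with hb
  have hab : ∀ v, v ^ 2 = a v + b v := fun v =>
    (congrFun (Set.indicator_self_add_compl A fun v : ℝ => v ^ 2) v).symm
  have ham : Measurable a := Measurable.indicator (by fun_prop) hAm
  have hbm : Measurable b := Measurable.indicator (by fun_prop) hAm.compl
  have hb0 : ∀ v, 0 ≤ b v := fun v => Set.indicator_nonneg (fun v _ => sq_nonneg v) v
  have ha_le : ∀ v, a v ^ 2 ≤ S ^ (4 - s) * |v| ^ s := by
    intro v
    by_cases hv : v ∈ A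
    · rw [ha, Set.indicator_of_mem hv]
      rcases (abs_nonneg v).eq_or_lt with h0 | h0
      · have : v = 0 := abs_eq_zero.1 h0.symm
        subst this; simp; positivity
      · calc (v ^ 2) ^ 2 = |v| ^ (4 - s) * |v| ^ s := by
              rw [← Real.rpow_add h0, ← sq_abs v, ← pow_mul, ← Real.rpow_natCast]
              norm_num
          _ ≤ _ := by
              gcongr
              exact hv
    · rw [ha, Set.indicator_of_notMem hv, zero_pow two_ne_zero]
      positivity
  -- The exponent `2 - s` is negative, so `|v| > S` gives `|v|^(2-s) ≤ S^(2-s)`.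
  have hb_le : ∀ v, b v ≤ S ^ (2 - s) * |v| ^ s := by
    intro v
    by_cases hv : v ∈ A
    · rw [hb, Set.indicator_of_notMem (by simpa using hv)]
      positivity
    · rw [hb, Set.indicator_of_mem (by simpa using hv)]
      have hv' : S < |v| := not_le.1 hv
      have h0 : 0 < |v| := hS0.trans hv'
      calc v ^ 2 = |v| ^ (2 - s) * |v| ^ s := by
              rw [← Real.rpow_add h0, ← sq_abs]
              norm_num
          _ ≤ _ := by
              gcongr ?_ * _
              exact Real.rpow_le_rpow_of_nonpos hS0 hv'.le (by linarith)
  have hbi : Integrable b ν := by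
    refine (hint.const_mul (S ^ (2 - s))).mono' hbm.aestronglyMeasurable (ae_of_all _ fun v => ?_)
    rw [Real.norm_of_nonneg (hb0 v)]
    exact hb_le v
  have ha2i : Integrable (fun v => a v ^ 2) ν := by
    refine (hint.const_mul (S ^ (4 - s))).mono' (ham.pow_const 2).aestronglyMeasurable
      (ae_of_all _ fun v => ?_)
    rw [Real.norm_of_nonneg (sq_nonneg _)]
    exact ha_le v
  have haL : MemLp a 2 ν := (memLp_two_iff_integrable_sq ham.aestronglyMeasurable).2 ha2i
  have hai : Integrable a ν := haL.integrable (by norm_num)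
  have hEb : ∫ v, b v ∂ν ≤ S ^ (2 - s) * K := by
    refine (integral_mono hbi (hint.const_mul (S ^ (2 - s))) hb_le).trans ?_
    rw [integral_const_mul]
    gcongr
  have hEa : ∫ v, a v ^ 2 ∂ν ≤ S ^ (4 - s) * K := by
    refine (integral_mono ha2i (hint.const_mul (S ^ (4 - s))) ha_le).trans ?_
    rw [integral_const_mul]
    gcongr
  have hsplit : (fun v : ℝ => v ^ 2) = fun v => a v + b v := funext hab
  refine ⟨hsplit ▸ hai.add hbi, ?_⟩
  have hS2 : S ^ (2 - s) = (N : ℝ) ^ (-(1 - 2 / s)) := by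
    rw [hS, ← Real.rpow_mul hN0.le]
    congr 1
    field_simp
    ring
  have hS4 : √(S ^ (4 - s) * K / N) = √K * (N : ℝ) ^ (-(1 - 2 / s)) := by
    have : S ^ (4 - s) * K / N = K * ((N : ℝ) ^ (-(1 - 2 / s))) ^ 2 := by
      rw [hS, ← Real.rpow_mul hN0.le, ← Real.rpow_natCast, ← Real.rpow_mul hN0.le,
        mul_comm, mul_div_assoc, ← Real.rpow_sub_one hN0.ne']
      congr 2
      push_cast
      field_simp
      ring
    rw [this, Real.sqrt_mul hK0, Real.sqrt_sq (by positivity)]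
  have hI1 := ((integrable_avg (N := N) hai).sub (integrable_const (∫ v, a v ∂ν))).abs
  have hI2 := ((integrable_avg (N := N) hbi).sub (integrable_const (∫ v, b v ∂ν))).abs
  calc _ = ∫ x : Fin N → ℝ, |(1 / N * ∑ j, a (x j) - ∫ v, a v ∂ν)
          + (1 / N * ∑ j, b (x j) - ∫ v, b v ∂ν)| ∂(Measure.pi fun _ => ν) := by
        congr 1 with x
        simp only [hab]
        rw [integral_add hai hbi, Finset.sum_add_distrib]
        congr 1
        ring
    _ ≤ ∫ x : Fin N → ℝ, (|1 / N * ∑ j, a (x j) - ∫ v, a v ∂ν|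
          + |1 / N * ∑ j, b (x j) - ∫ v, b v ∂ν|) ∂(Measure.pi fun _ => ν) := by
        refine integral_mono_of_nonneg (ae_of_all _ fun x => abs_nonneg _) (hI1.add hI2)
          (ae_of_all _ fun x => abs_add_le _ _)
    _ ≤ √((∫ v, a v ^ 2 ∂ν) / N) + 2 * ∫ v, b v ∂ν := by
        refine (integral_add hI1 hI2).trans_le ?_
        exact add_le_add (integral_abs_avg_sub_le_sqrt hN haL) (integral_abs_avg_sub_le hN hbi hb0)
    _ ≤ √(S ^ (4 - s) * K / N) + 2 * (S ^ (2 - s) * K) := by gcongr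
    _ = _ := by rw [hS4, hS2]; ring

end Average

/-! ### Rescaling onto the sphere, exchangeability and support -/

theorem sq_sqrt_sub_sqrt_le {p q : ℝ} (hp : 0 ≤ p) (hq : 0 ≤ q) : (√p - √q) ^ 2 ≤ |q - p| := by
  have h1 := Real.sqrt_nonneg p
  have h2 := Real.sqrt_nonneg q
  have h : |q - p| = |√p - √q| * (√p + √q) := by
    rw [← abs_of_nonneg (add_nonneg h1 h2), ← abs_mul, abs_sub_comm]
    congr 1
    nlinarith [Real.sq_sqrt hp, Real.sq_sqrt hq]
  rw [h, ← sq_abs, sq]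
  gcongr
  exact abs_le.2 ⟨by linarith, by linarith⟩

theorem rescale_mem_kacSphere {N : ℕ} {E : ℝ} (hN : 1 ≤ N) (hE : 0 ≤ E) {x z : Fin N → ℝ}
    (hz : z ∈ kacSphere N E) : rescale E x z ∈ kacSphere N E := by
  have hN' : (0 : ℝ) < N := by positivity
  unfold rescale
  split_ifs with h
  · change ∑ i, (√(E / (1 / N * ∑ j, x j ^ 2)) * x i) ^ 2 = N * E
    simp only [mul_pow, ← Finset.mul_sum]
    rw [Real.sq_sqrt (by positivity)]
    field_simp
  · exact hz

/-- A vector and its positive multiple differ in norm by exactly their distance. If `x = 0`, both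
sides equal `E` because `z` lies on the sphere. -/
theorem avg_sq_rescale_sub {N : ℕ} {E : ℝ} (hN : 1 ≤ N) (hE : 0 ≤ E) {x z : Fin N → ℝ}
    (hz : z ∈ kacSphere N E) :
    1 / N * ∑ i, (rescale E x z i - x i) ^ 2 = (√E - √(1 / N * ∑ j, x j ^ 2)) ^ 2 := by
  have hN' : (0 : ℝ) < N := by positivity
  unfold rescale
  split_ifs with h
  · have hQ : 0 < 1 / (N : ℝ) * ∑ j, x j ^ 2 := by positivity
    have h1 : ∀ i, (√(E / (1 / N * ∑ j, x j ^ 2)) * x i - x i) ^ 2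
        = (√(E / (1 / N * ∑ j, x j ^ 2)) - 1) ^ 2 * x i ^ 2 := fun i => by ring
    simp only [h1]
    rw [← Finset.mul_sum, mul_left_comm, Real.sqrt_div hE]
    generalize 1 / (N : ℝ) * ∑ j, x j ^ 2 = Q at hQ
    have hs : 0 < √Q := Real.sqrt_pos.2 hQ
    nth_rewrite 2 [← Real.sq_sqrt hQ.le]
    field_simp
  · have h0 : ∑ j, x j ^ 2 = 0 :=
      le_antisymm (not_lt.1 h) (Finset.sum_nonneg fun _ _ => sq_nonneg _)
    have hx : ∀ i, x i = 0 := fun i =>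
      pow_eq_zero_iff two_ne_zero |>.1
        ((Finset.sum_eq_zero_iff_of_nonneg fun _ _ => sq_nonneg _).1 h0 i (Finset.mem_univ i))
    have hz' : ∑ i, z i ^ 2 = N * E := hz
    rw [h0]
    simp only [hx, sub_zero, hz', mul_zero, Real.sqrt_zero, Real.sq_sqrt hE]
    field_simp

theorem rescale_comp_perm {N : ℕ} (E : ℝ) (x z : Fin N → ℝ) (σ : Equiv.Perm (Fin N)) :
    rescale E (fun i => x (σ i)) (fun i => z (σ i)) = fun i => rescale E x z (σ i) := by
  unfold rescale
  rw [Equiv.sum_comp σ fun j => x j ^ 2]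
  split_ifs <;> rfl

-- A subfamily of i.i.d. coordinates is i.i.d. Used for permutations and for restriction to the
-- first `k` coordinates.
open ProbabilityTheory in
theorem map_comp_pi_of_injective {ι κ α : Type*} [Fintype ι] [Fintype κ] [MeasurableSpace α]
    {ν : Measure α} [IsProbabilityMeasure ν] {g : κ → ι} (hg : Function.Injective g) :
    (Measure.pi fun _ : ι => ν).map (fun x k => x (g k)) = Measure.pi fun _ : κ => ν := by
  have h : iIndepFun (fun (i : ι) (x : ι → α) => x i) (Measure.pi fun _ => ν) :=
    iIndepFun_pi (X := fun _ => id) fun _ => aemeasurable_id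
  have h2 := h.precomp hg
  rw [iIndepFun_iff_map_fun_eq_pi_map fun k => (measurable_pi_apply (g k)).aemeasurable] at h2
  simpa only [fun i => (measurePreserving_eval (fun _ : ι => ν) i).map_eq] using h2

/-- The joint law of `(X, Z)`. -/
noncomputable abbrev jointLaw (f : ProbabilityMeasure ℝ) {N : ℕ}
    (ζ : ProbabilityMeasure (Fin N → ℝ)) : Measure ((Fin N → ℝ) × (Fin N → ℝ)) :=
  (Measure.pi fun _ => (f : Measure ℝ)).prod ζ

theorem coe_rescaledLaw (f : ProbabilityMeasure ℝ) (E : ℝ) {N : ℕ}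
    (ζ : ProbabilityMeasure (Fin N → ℝ)) :
    (rescaledLaw f E ζ : Measure (Fin N → ℝ))
      = (jointLaw f ζ).map fun p => rescale E p.1 p.2 := rfl

theorem ae_snd_jointLaw (f : ProbabilityMeasure ℝ) {N : ℕ} {ζ : ProbabilityMeasure (Fin N → ℝ)}
    {p : (Fin N → ℝ) → Prop} (h : ∀ᵐ z ∂(ζ : Measure (Fin N → ℝ)), p z) :
    ∀ᵐ q ∂(jointLaw f ζ), p q.2 :=
  Measure.quasiMeasurePreserving_snd.ae h

theorem measurePreserving_perm_jointLaw (f : ProbabilityMeasure ℝ) {N : ℕ}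
    {ζ : ProbabilityMeasure (Fin N → ℝ)} (hζ : IsSymmetricLaw ζ) (σ : Equiv.Perm (Fin N)) :
    MeasurePreserving (Prod.map (fun x i => x (σ i)) (fun z i => z (σ i)))
      (jointLaw f ζ) (jointLaw f ζ) :=
  MeasurePreserving.prod
    ⟨measurable_pi_lambda _ fun i => measurable_pi_apply (σ i),
      map_comp_pi_of_injective σ.injective⟩
    ⟨measurable_pi_lambda _ fun i => measurable_pi_apply (σ i), hζ σ⟩

theorem isSymmetricLaw_rescaledLaw (f : ProbabilityMeasure ℝ) (E : ℝ) {N : ℕ}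
    {ζ : ProbabilityMeasure (Fin N → ℝ)} (hζ : IsSymmetricLaw ζ) :
    IsSymmetricLaw (rescaledLaw f E ζ) := by
  intro σ
  have hp := measurePreserving_perm_jointLaw f hζ σ
  rw [coe_rescaledLaw, Measure.map_map
    (measurable_pi_lambda _ fun i => measurable_pi_apply (σ i)) (measurable_rescale E)]
  conv_rhs => rw [← hp.map_eq, Measure.map_map (measurable_rescale E) hp.measurable]
  congr 1
  ext1 p
  exact (rescale_comp_perm E p.1 p.2 σ).symm

theorem ae_mem_kacSphere_rescaledLaw (f : ProbabilityMeasure ℝ) {E : ℝ} {N : ℕ} (hN : 1 ≤ N)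
    (hE : 0 ≤ E) {ζ : ProbabilityMeasure (Fin N → ℝ)}
    (hζ : ∀ᵐ z ∂(ζ : Measure (Fin N → ℝ)), z ∈ kacSphere N E) :
    ∀ᵐ y ∂(rescaledLaw f E ζ : Measure (Fin N → ℝ)), y ∈ kacSphere N E := by
  rw [coe_rescaledLaw, ae_map_iff (measurable_rescale E).aemeasurable (p := (· ∈ kacSphere N E))
    (measurableSet_eq_fun (by fun_prop) measurable_const)]
  exact (ae_snd_jointLaw f hζ).mono fun p hp => rescale_mem_kacSphere hN hE hp

/-! ### Wasserstein bounds -/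

theorem sq_rpow_half (a : ℝ≥0∞) : (a ^ (1 / 2 : ℝ)) ^ 2 = a := by
  rw [← ENNReal.rpow_natCast, ← ENNReal.rpow_mul]
  norm_num

theorem W2_rescaledLaw_sq_le (f : ProbabilityMeasure ℝ) {E : ℝ} {N : ℕ} (hN : 1 ≤ N)
    (hE : 0 ≤ E) {ζ : ProbabilityMeasure (Fin N → ℝ)}
    (hζ : ∀ᵐ z ∂(ζ : Measure (Fin N → ℝ)), z ∈ kacSphere N E) :
    W2 (rescaledLaw f E ζ : Measure (Fin N → ℝ)) (tensorPower f N) ^ 2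
      ≤ ∫⁻ x : Fin N → ℝ, ENNReal.ofReal ((√E - √(1 / N * ∑ j, x j ^ 2)) ^ 2)
          ∂(Measure.pi fun _ => (f : Measure ℝ)) := by
  have hm : Measurable fun p : (Fin N → ℝ) × (Fin N → ℝ) => (rescale E p.1 p.2, p.1) :=
    (measurable_rescale E).prodMk measurable_fst
  rw [W2, sq_rpow_half]
  refine (iInf₂_le ((jointLaw f ζ).map fun p => (rescale E p.1 p.2, p.1)) (And.intro ?fst ?snd)).trans ?_
  case fst =>
    rw [Measure.map_map measurable_fst hm, coe_rescaledLaw]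
    rfl
  case snd =>
    rw [Measure.map_map measurable_snd hm]
    exact measurePreserving_fst.map_eq
  rw [lintegral_map (by fun_prop) hm]
  calc _ = ∫⁻ p, ENNReal.ofReal ((√E - √(1 / N * ∑ j, p.1 j ^ 2)) ^ 2) ∂(jointLaw f ζ) := by
        refine lintegral_congr_ae ((ae_snd_jointLaw f hζ).mono fun p hp => ?_)
        simp only [sq_abs]
        rw [avg_sq_rescale_sub hN hE hp]
    _ ≤ _ := by
        rw [← measurePreserving_fst.lintegral_comp (μ := jointLaw f ζ) (by fun_prop)]

/-- Under a coupling `γ` the two square roots are the `L²(γ)` norms of the coordinates, so the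
reverse triangle inequality bounds their difference by the `L²(γ)` norm of `p.1 - p.2`. -/
theorem ofReal_sq_sqrt_sub_le_W2Line_sq {μ ν : Measure ℝ}
    (hμ : Integrable (fun v : ℝ => v ^ 2) μ) (hν : Integrable (fun v : ℝ => v ^ 2) ν) :
    ENNReal.ofReal ((√(∫ v, v ^ 2 ∂ν) - √(∫ v, v ^ 2 ∂μ)) ^ 2) ≤ W2Line μ ν ^ 2 := by
  rw [W2Line, sq_rpow_half]
  refine le_iInf₂ fun γ hγ => ?_
  have key : ∀ {ρ : Measure ℝ}, Integrable (fun v : ℝ => v ^ 2) ρ →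
      eLpNorm id 2 ρ = ENNReal.ofReal √(∫ v, v ^ 2 ∂ρ) := by
    intro ρ hρ
    have hL : MemLp id 2 ρ := (memLp_two_iff_integrable_sq aestronglyMeasurable_id).2 hρ
    rw [hL.eLpNorm_eq_integral_rpow_norm (by norm_num) (by norm_num)]
    norm_num [Real.sqrt_eq_rpow]
  have h1 : eLpNorm (Prod.fst : ℝ × ℝ → ℝ) 2 γ = ENNReal.ofReal √(∫ v, v ^ 2 ∂μ) := by
    rw [← key hμ, ← hγ.1, eLpNorm_map_measure aestronglyMeasurable_id measurable_fst.aemeasurable]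
    rfl
  have h2 : eLpNorm (Prod.snd : ℝ × ℝ → ℝ) 2 γ = ENNReal.ofReal √(∫ v, v ^ 2 ∂ν) := by
    rw [← key hν, ← hγ.2, eLpNorm_map_measure aestronglyMeasurable_id measurable_snd.aemeasurable]
    rfl
  set D := eLpNorm (fun p : ℝ × ℝ => p.1 - p.2) 2 γ with hD
  have hDsq : D ^ 2 = ∫⁻ p, ENNReal.ofReal (|p.1 - p.2| ^ 2) ∂γ := by
    rw [hD, eLpNorm_eq_lintegral_rpow_enorm_toReal (by norm_num) (by norm_num)]
    simp only [ENNReal.toReal_ofNat]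
    rw [sq_rpow_half]
    refine lintegral_congr fun p => ?_
    rw [ENNReal.ofReal_pow (abs_nonneg _), ← Real.norm_eq_abs, ofReal_norm]
    norm_num
  rw [← hDsq]
  have t1 : eLpNorm (Prod.fst : ℝ × ℝ → ℝ) 2 γ ≤ D + eLpNorm (Prod.snd : ℝ × ℝ → ℝ) 2 γ := by
    have := eLpNorm_add_le (μ := γ) (p := 2) (f := fun p : ℝ × ℝ => p.1 - p.2)
      (g := (Prod.snd : ℝ × ℝ → ℝ)) (by fun_prop) (by fun_prop) (by norm_num)
    have e : ((fun p : ℝ × ℝ => p.1 - p.2) + (Prod.snd : ℝ × ℝ → ℝ)) = Prod.fst := by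
      ext p; simp
    rwa [e] at this
  have t2 : eLpNorm (Prod.snd : ℝ × ℝ → ℝ) 2 γ ≤ eLpNorm (Prod.fst : ℝ × ℝ → ℝ) 2 γ + D := by
    have := eLpNorm_sub_le (μ := γ) (p := 2) (f := (Prod.fst : ℝ × ℝ → ℝ))
      (g := fun p : ℝ × ℝ => p.1 - p.2) (by fun_prop) (by fun_prop) (by norm_num)
    have e : ((Prod.fst : ℝ × ℝ → ℝ) - fun p : ℝ × ℝ => p.1 - p.2) = Prod.snd := by
      ext p; simp
    rwa [e] at this
  rw [h1, h2] at t1 t2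
  -- A coupling of infinite cost gives a trivial bound; otherwise the inequalities pass to real
  -- numbers.
  rcases eq_or_ne D ⊤ with hT | hT
  · simp [hT]
  rw [← ENNReal.ofReal_toReal hT] at t1 t2 ⊢
  rw [← ENNReal.ofReal_add (by positivity) (by positivity),
    ENNReal.ofReal_le_ofReal_iff (by positivity)] at t1 t2
  rw [← ENNReal.ofReal_pow (by positivity)]
  refine ENNReal.ofReal_le_ofReal (sq_le_sq.2 ?_)
  rw [abs_of_nonneg (a := D.toReal) (by positivity)]
  exact abs_le.2 ⟨by linarith, by linarith⟩

theorem integrable_empiricalMeasure {N : ℕ} (hN : 1 ≤ N) (x : Fin N → ℝ) (φ : ℝ → ℝ) :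
    Integrable φ (empiricalMeasure x) := by
  have : (N : ℝ≥0∞) ≠ 0 := by positivity
  refine Integrable.smul_measure ?_ (ENNReal.inv_ne_top.2 this)
  exact integrable_finsetSum_measure.2 fun i _ => integrable_dirac (by simp)

theorem integral_empiricalMeasure {N : ℕ} (x : Fin N → ℝ) (φ : ℝ → ℝ) :
    ∫ v, φ v ∂(empiricalMeasure x) = 1 / N * ∑ i, φ (x i) := by
  rw [empiricalMeasure, integral_smul_measure,
    integral_finsetSum_measure fun i _ => integrable_dirac (by simp)]
  simp

theorem lintegral_sq_sqrt_sub_le_epsilonN {f : ProbabilityMeasure ℝ} {N : ℕ} (hN : 1 ≤ N)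
    (hf : Integrable (fun v : ℝ => v ^ 2) (f : Measure ℝ)) :
    ∫⁻ x : Fin N → ℝ, ENNReal.ofReal ((√(∫ v, v ^ 2 ∂(f : Measure ℝ))
        - √(1 / N * ∑ j, x j ^ 2)) ^ 2) ∂(Measure.pi fun _ => (f : Measure ℝ))
      ≤ epsilonN N f := by
  refine lintegral_mono fun x => ?_
  rw [← integral_empiricalMeasure x fun v => v ^ 2]
  exact ofReal_sq_sqrt_sub_le_W2Line_sq (integrable_empiricalMeasure hN x _) hf

/-! ### Rates from moments -/

theorem integrable_abs_rpow_of_le {ν : Measure ℝ} [IsProbabilityMeasure ν] {s r : ℝ}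
    (hs : 0 < s) (hsr : s ≤ r) (hint : Integrable (fun v : ℝ => |v| ^ r) ν) :
    Integrable (fun v : ℝ => |v| ^ s) ν ∧
      ∫ v, |v| ^ s ∂ν ≤ ∫ v, |v| ^ r ∂ν + 1 := by
  have hle : ∀ v : ℝ, |v| ^ s ≤ |v| ^ r + 1 := by
    intro v
    rcases le_total |v| 1 with h | h
    · have := Real.rpow_le_one (abs_nonneg v) h hs.le
      have : 0 ≤ |v| ^ r := by positivity
      linarith
    · have := Real.rpow_le_rpow_of_exponent_le h hsr
      linarith
  have hi : Integrable (fun v : ℝ => |v| ^ s) ν := by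
    refine (hint.add (integrable_const 1)).mono'
      (Measurable.aestronglyMeasurable (by fun_prop)) (ae_of_all _ fun v => ?_)
    rw [Real.norm_of_nonneg (by positivity)]
    exact hle v
  refine ⟨hi, (integral_mono hi (hint.add (integrable_const 1)) hle).trans ?_⟩
  simp [integral_add hint (integrable_const (1 : ℝ))]

theorem integral_sq_sqrt_sub_le {ν : Measure ℝ} [IsProbabilityMeasure ν] {N : ℕ} {s K : ℝ}
    (hs : 2 < s) (hs4 : s ≤ 4) (hN : 1 ≤ N)
    (hint : Integrable (fun v : ℝ => |v| ^ s) ν) (hK : ∫ v, |v| ^ s ∂ν ≤ K) :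
    Integrable (fun x : Fin N → ℝ => (√(∫ v, v ^ 2 ∂ν) - √(1 / N * ∑ j, x j ^ 2)) ^ 2)
      (Measure.pi fun _ => ν) ∧
    ∫ x : Fin N → ℝ, (√(∫ v, v ^ 2 ∂ν) - √(1 / N * ∑ j, x j ^ 2)) ^ 2 ∂(Measure.pi fun _ => ν)
      ≤ (√K + 2 * K) * (N : ℝ) ^ (-(1 - 2 / s)) := by
  obtain ⟨h2, hle⟩ := integral_abs_avg_sq_sub_le hs hs4 hN hint hK
  have hdom : ∀ x : Fin N → ℝ, (√(∫ v, v ^ 2 ∂ν) - √(1 / N * ∑ j, x j ^ 2)) ^ 2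
      ≤ |1 / N * ∑ j, x j ^ 2 - ∫ v, v ^ 2 ∂ν| := fun x =>
    sq_sqrt_sub_sqrt_le (integral_nonneg fun v => sq_nonneg v) (by positivity)
  have hi := ((integrable_avg (N := N) h2).sub (integrable_const (∫ v, v ^ 2 ∂ν))).abs
  have hg : Integrable (fun x : Fin N → ℝ => (√(∫ v, v ^ 2 ∂ν) - √(1 / N * ∑ j, x j ^ 2)) ^ 2)
      (Measure.pi fun _ => ν) :=
    hi.mono' (Measurable.aestronglyMeasurable (by fun_prop)) (ae_of_all _ fun x => by
      rw [Real.norm_of_nonneg (sq_nonneg _)]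
      exact hdom x)
  exact ⟨hg, (integral_mono hg hi hdom).trans hle⟩

theorem W2_rescaledLaw_sq_le_rpow {f : ProbabilityMeasure ℝ} {N : ℕ} {s K : ℝ}
    (hs : 2 < s) (hs4 : s ≤ 4) (hN : 1 ≤ N)
    (hint : Integrable (fun v : ℝ => |v| ^ s) (f : Measure ℝ))
    (hK : ∫ v, |v| ^ s ∂(f : Measure ℝ) ≤ K) {E : ℝ} (hE : ∫ v, v ^ 2 ∂(f : Measure ℝ) = E)
    {ζ : ProbabilityMeasure (Fin N → ℝ)}
    (hζ : ∀ᵐ z ∂(ζ : Measure (Fin N → ℝ)), z ∈ kacSphere N E) :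
    W2 (rescaledLaw f E ζ : Measure (Fin N → ℝ)) (tensorPower f N) ^ 2
      ≤ ENNReal.ofReal ((√K + 2 * K) * (N : ℝ) ^ (-(1 - 2 / s))) := by
  obtain ⟨hg, hle⟩ := integral_sq_sqrt_sub_le hs hs4 hN hint hK
  have hE0 : 0 ≤ E := hE ▸ integral_nonneg fun v => sq_nonneg v
  refine (W2_rescaledLaw_sq_le f hN hE0 hζ).trans ?_
  rw [hE] at hg hle
  rw [← ofReal_integral_eq_lintegral_ofReal hg (ae_of_all _ fun x => sq_nonneg _)]
  exact ENNReal.ofReal_le_ofReal hle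

/-! ### Propagation to marginals and chaos -/

/-- By exchangeability all coordinates of `Y - X` have the same second moment. -/
theorem integral_sq_rescale_sub {f : ProbabilityMeasure ℝ} {E : ℝ} {N : ℕ} (hN : 1 ≤ N)
    (hE : 0 ≤ E) {ζ : ProbabilityMeasure (Fin N → ℝ)} (hsym : IsSymmetricLaw ζ)
    (hζ : ∀ᵐ z ∂(ζ : Measure (Fin N → ℝ)), z ∈ kacSphere N E)
    (hg : Integrable (fun x : Fin N → ℝ => (√E - √(1 / N * ∑ j, x j ^ 2)) ^ 2)
      (Measure.pi fun _ => (f : Measure ℝ))) (i : Fin N) :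
    MemLp (fun p : (Fin N → ℝ) × (Fin N → ℝ) => rescale E p.1 p.2 i - p.1 i) 2 (jointLaw f ζ) ∧
    ∫ p, (rescale E p.1 p.2 i - p.1 i) ^ 2 ∂(jointLaw f ζ)
      = ∫ x : Fin N → ℝ, (√E - √(1 / N * ∑ j, x j ^ 2)) ^ 2
          ∂(Measure.pi fun _ => (f : Measure ℝ)) := by
  have hN' : (0 : ℝ) < N := by positivity
  have hm : ∀ j, Measurable fun p : (Fin N → ℝ) × (Fin N → ℝ) => rescale E p.1 p.2 j - p.1 j :=
    fun j => ((measurable_pi_apply j).comp (measurable_rescale E)).sub (by fun_prop)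
  have hgP := (measurePreserving_fst (μ := Measure.pi fun _ : Fin N => (f : Measure ℝ))
    (ν := (ζ : Measure (Fin N → ℝ)))).integrable_comp_of_integrable hg
  have hae : ∀ᵐ p ∂(jointLaw f ζ), ∑ j, (rescale E p.1 p.2 j - p.1 j) ^ 2
      = N * (√E - √(1 / N * ∑ j, p.1 j ^ 2)) ^ 2 :=
    (ae_snd_jointLaw f hζ).mono fun p hp => by
      rw [← avg_sq_rescale_sub hN hE hp]
      field_simp
  -- Each term is dominated by the whole sum, which is almost surely `N (√E - √Q)²`.
  have hint : ∀ j, Integrable (fun p : (Fin N → ℝ) × (Fin N → ℝ) =>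
      (rescale E p.1 p.2 j - p.1 j) ^ 2) (jointLaw f ζ) := fun j =>
    (hgP.const_mul (N : ℝ)).mono' ((hm j).pow_const 2).aestronglyMeasurable
      (hae.mono fun p hp => by
        rw [Real.norm_of_nonneg (sq_nonneg _)]
        refine le_trans ?_ hp.le
        exact Finset.single_le_sum (f := fun j => (rescale E p.1 p.2 j - p.1 j) ^ 2)
          (fun _ _ => sq_nonneg _) (Finset.mem_univ j))
  refine ⟨(memLp_two_iff_integrable_sq (hm i).aestronglyMeasurable).2 (hint i), ?_⟩
  have hswap : ∀ j, ∫ p, (rescale E p.1 p.2 j - p.1 j) ^ 2 ∂(jointLaw f ζ)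
      = ∫ p, (rescale E p.1 p.2 i - p.1 i) ^ 2 ∂(jointLaw f ζ) := by
    intro j
    have hp := measurePreserving_perm_jointLaw f hsym (Equiv.swap i j)
    conv_rhs => rw [← hp.map_eq]
    rw [integral_map hp.measurable.aemeasurable ((hm i).pow_const 2).aestronglyMeasurable]
    refine integral_congr_ae (ae_of_all _ fun p => ?_)
    simp only [Prod.map, rescale_comp_perm, Equiv.swap_apply_left]
  have hsum : ∑ j, ∫ p, (rescale E p.1 p.2 j - p.1 j) ^ 2 ∂(jointLaw f ζ)
      = N * ∫ x : Fin N → ℝ, (√E - √(1 / N * ∑ j, x j ^ 2)) ^ 2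
          ∂(Measure.pi fun _ => (f : Measure ℝ)) := by
    rw [← integral_finsetSum _ fun j _ => hint j, integral_congr_ae hae, integral_const_mul]
    congr 1
    exact integral_fun_fst (ν := (ζ : Measure (Fin N → ℝ)))
      (fun x : Fin N → ℝ => (√E - √(1 / N * ∑ j, x j ^ 2)) ^ 2) |>.trans (by simp)
  simp only [hswap] at hsum
  simpa [hN'.ne'] using hsum

/-- Both marginals are images of the joint law of `(X, Z)`, so the difference is at most `L` times
the mean sup distance of the first `k` coordinates, itself at most a sum of `k` terms, each bounded
by `√D`. -/
theorem abs_integral_firstMarginal_sub_le {f : ProbabilityMeasure ℝ} {E : ℝ} {k m : ℕ}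
    {ζ : ProbabilityMeasure (Fin (k + m) → ℝ)} {D : ℝ}
    (hL : ∀ i, MemLp (fun p : (Fin (k + m) → ℝ) × (Fin (k + m) → ℝ) =>
      rescale E p.1 p.2 i - p.1 i) 2 (jointLaw f ζ))
    (hD : ∀ i, ∫ p, (rescale E p.1 p.2 i - p.1 i) ^ 2 ∂(jointLaw f ζ) ≤ D)
    {φ : (Fin k → ℝ) → ℝ} {B : ℝ} (hB : ∀ x y, dist (φ x) (φ y) ≤ B) {L : NNReal}
    (hφ : LipschitzWith L φ) :
    |∫ y, φ y ∂(firstMarginal k m (rescaledLaw f E ζ) : Measure (Fin k → ℝ))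
        - ∫ y, φ y ∂(tensorPower f k : Measure (Fin k → ℝ))| ≤ L * (k * √D) := by
  have hπ : Measurable fun (x : Fin (k + m) → ℝ) (i : Fin k) => x (Fin.castAdd m i) :=
    measurable_pi_lambda _ fun i => measurable_pi_apply (Fin.castAdd m i)
  have hY : Measurable fun (p : (Fin (k + m) → ℝ) × (Fin (k + m) → ℝ)) (i : Fin k) =>
      rescale E p.1 p.2 (Fin.castAdd m i) := hπ.comp (measurable_rescale E)
  have hX : Measurable fun (p : (Fin (k + m) → ℝ) × (Fin (k + m) → ℝ)) (i : Fin k) =>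
      p.1 (Fin.castAdd m i) := hπ.comp measurable_fst
  have e1 : ∫ y, φ y ∂(firstMarginal k m (rescaledLaw f E ζ) : Measure (Fin k → ℝ))
      = ∫ p, φ (fun i => rescale E p.1 p.2 (Fin.castAdd m i)) ∂(jointLaw f ζ) := by
    have : (firstMarginal k m (rescaledLaw f E ζ) : Measure (Fin k → ℝ))
        = (jointLaw f ζ).map fun p i => rescale E p.1 p.2 (Fin.castAdd m i) :=
      Measure.map_map hπ (measurable_rescale E)
    rw [this, integral_map hY.aemeasurable hφ.continuous.aestronglyMeasurable]
  have e2 : ∫ y, φ y ∂(tensorPower f k : Measure (Fin k → ℝ))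
      = ∫ p, φ (fun i => p.1 (Fin.castAdd m i)) ∂(jointLaw f ζ) := by
    have : (tensorPower f k : Measure (Fin k → ℝ))
        = (jointLaw f ζ).map fun p i => p.1 (Fin.castAdd m i) := by
      refine (map_comp_pi_of_injective (Fin.castAdd_injective k m)).symm.trans ?_
      rw [← (measurePreserving_fst (μ := Measure.pi fun _ : Fin (k + m) => (f : Measure ℝ))
        (ν := (ζ : Measure (Fin (k + m) → ℝ)))).map_eq, Measure.map_map hπ measurable_fst]
      rfl
    rw [this, integral_map hX.aemeasurable hφ.continuous.aestronglyMeasurable]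
  have hbdd : ∀ x, ‖φ x‖ ≤ ‖φ 0‖ + B := fun x => by
    have := hB x 0
    rw [dist_eq_norm] at this
    have := norm_le_norm_add_norm_sub' (φ x) (φ 0)
    linarith
  have i1 := Integrable.of_bound (μ := jointLaw f ζ)
    (hφ.continuous.measurable.comp hY).aestronglyMeasurable _ (ae_of_all _ fun p => hbdd _)
  have i2 := Integrable.of_bound (μ := jointLaw f ζ)
    (hφ.continuous.measurable.comp hX).aestronglyMeasurable _ (ae_of_all _ fun p => hbdd _)
  have i3 : ∀ i, Integrable (fun p : (Fin (k + m) → ℝ) × (Fin (k + m) → ℝ) =>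
      |rescale E p.1 p.2 i - p.1 i|) (jointLaw f ζ) := fun i =>
    ((hL i).integrable (by norm_num)).abs
  rw [e1, e2]
  refine (congrArg abs (integral_sub i1 i2).symm).trans_le (abs_integral_le_integral_abs.trans ?_)
  calc _ ≤ ∫ p, L * ∑ i : Fin k, |rescale E p.1 p.2 (Fin.castAdd m i) - p.1 (Fin.castAdd m i)|
          ∂(jointLaw f ζ) := by
        refine integral_mono (i1.sub i2).abs
          ((integrable_finsetSum _ fun i _ => i3 (Fin.castAdd m i)).const_mul _) fun p => ?_
        refine (hφ.dist_le_mul _ _).trans ?_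
        gcongr
        refine (dist_pi_le_iff (Finset.sum_nonneg fun _ _ => abs_nonneg _)).2 fun i => ?_
        exact Finset.single_le_sum
          (f := fun i => |rescale E p.1 p.2 (Fin.castAdd m i) - p.1 (Fin.castAdd m i)|)
          (fun _ _ => abs_nonneg _) (Finset.mem_univ i)
    _ ≤ L * ∑ _i : Fin k, √D := by
        rw [integral_const_mul, integral_finsetSum _ fun i _ => i3 (Fin.castAdd m i)]
        gcongr with i
        exact (integral_abs_le_sqrt_integral_sq (hL _)).trans (Real.sqrt_le_sqrt (hD _))
    _ = _ := by simp

theorem isChaotic_rescaledLaw {f : ProbabilityMeasure ℝ} {s : ℝ}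
    (hs : 2 < s) (hs4 : s ≤ 4) (hint : Integrable (fun v : ℝ => |v| ^ s) (f : Measure ℝ))
    {E : ℝ} (hE : ∫ v, v ^ 2 ∂(f : Measure ℝ) = E)
    {ζ : ∀ N : ℕ, ProbabilityMeasure (Fin N → ℝ)} (hsym : ∀ N, IsSymmetricLaw (ζ N))
    (hζ : ∀ N, ∀ᵐ z ∂(ζ N : Measure (Fin N → ℝ)), z ∈ kacSphere N E) :
    IsChaotic (fun N => rescaledLaw f E (ζ N)) f := by
  refine ⟨fun N => isSymmetricLaw_rescaledLaw f E (hsym N), fun k => ?_⟩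
  have hE0 : 0 ≤ E := hE ▸ integral_nonneg fun v => sq_nonneg v
  rw [tendsto_iff_forall_lipschitz_integral_tendsto]
  rintro φ ⟨B, hB⟩ ⟨L, hφ⟩
  set K := ∫ v, |v| ^ s ∂(f : Measure ℝ) with hK
  have hα : 0 < 1 - 2 / s := by
    rw [sub_pos, div_lt_one (by linarith)]
    exact hs
  have hlim : Tendsto (fun m : ℕ => L * (k * √((√K + 2 * K) *
      ((k + m : ℕ) : ℝ) ^ (-(1 - 2 / s))))) atTop (𝓝 0) := by
    have h1 : Tendsto (fun m : ℕ => ((k + m : ℕ) : ℝ)) atTop atTop :=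
      tendsto_natCast_atTop_atTop.comp (tendsto_atTop_mono (fun m => Nat.le_add_left m k) tendsto_id)
    have h2 := ((tendsto_rpow_neg_atTop hα).comp h1).const_mul (√K + 2 * K)
    have h3 := (((Real.continuous_sqrt.tendsto _).comp h2).const_mul (k : ℝ)).const_mul (L : ℝ)
    simpa [Function.comp_def] using h3
  refine tendsto_iff_dist_tendsto_zero.2
    (squeeze_zero' (Eventually.of_forall fun _ => dist_nonneg) ?_ hlim)
  -- `m ≥ 1` ensures `k + m ≥ 1` even when `k = 0`.
  filter_upwards [eventually_ge_atTop 1] with m hm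
  have hN : 1 ≤ k + m := by omega
  obtain ⟨hg, hle⟩ := integral_sq_sqrt_sub_le (N := k + m) hs hs4 hN hint hK.symm.le
  rw [hE] at hg hle
  have h := integral_sq_rescale_sub hN hE0 (hsym _) (hζ _) hg
  exact abs_integral_firstMarginal_sub_le (fun i => (h i).1) (fun i => (h i).2.trans_le hle) hB hφ

theorem theorem3 :
    ∃ C : ℝ → ℝ → ℝ, ∀ (r : ℝ) (_ : 2 < r) (f : ProbabilityMeasure ℝ) (E : ℝ)
      (_ : Integrable (fun v : ℝ => |v| ^ r) (f : Measure ℝ))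
      (_ : ∫ v, v ^ 2 ∂(f : Measure ℝ) = E)
      (ζ : ∀ N : ℕ, ProbabilityMeasure (Fin N → ℝ))
      (_ : ∀ N, IsSymmetricLaw (ζ N))
      (_ : ∀ N, ∀ᵐ z ∂(ζ N : Measure (Fin N → ℝ)), z ∈ kacSphere N E),
      (∀ N, 1 ≤ N → ∀ᵐ y ∂(rescaledLaw f E (ζ N) : Measure (Fin N → ℝ)), y ∈ kacSphere N E) ∧
      IsChaotic (fun N => rescaledLaw f E (ζ N)) f ∧
      (∀ N : ℕ, 1 ≤ N →
        W2 (rescaledLaw f E (ζ N) : Measure (Fin N → ℝ)) (tensorPower f N) ^ 2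
          ≤ epsilonN N f) ∧
      (4 < r → ∀ N : ℕ, 1 ≤ N →
        W2 (rescaledLaw f E (ζ N) : Measure (Fin N → ℝ)) (tensorPower f N) ^ 2
          ≤ ENNReal.ofReal (C r (∫ v, |v| ^ r ∂(f : Measure ℝ)) * (N : ℝ) ^ (-(1 / 2) : ℝ))) ∧
      (r = 4 → ∀ N : ℕ, 2 ≤ N →
        W2 (rescaledLaw f E (ζ N) : Measure (Fin N → ℝ)) (tensorPower f N) ^ 2
          ≤ ENNReal.ofReal (C r (∫ v, |v| ^ r ∂(f : Measure ℝ)) *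
              ((N : ℝ) ^ (-(1 / 2) : ℝ) * Real.log N))) ∧
      (r < 4 → ∀ N : ℕ, 1 ≤ N →
        W2 (rescaledLaw f E (ζ N) : Measure (Fin N → ℝ)) (tensorPower f N) ^ 2
          ≤ ENNReal.ofReal (C r (∫ v, |v| ^ r ∂(f : Measure ℝ)) *
              (N : ℝ) ^ (-(1 - 2 / r) : ℝ))) := by
  -- `M + 1` bounds the moment of order `min r 4`, since `|v|^s ≤ |v|^r + 1`; the factor `2` is
  -- needed only to absorb the logarithm at `r = 4`.
  refine ⟨fun _ M => 2 * (√(M + 1) + 2 * (M + 1)), fun r hr f E hint hE ζ hsym hζ => ?_⟩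
  have hE0 : 0 ≤ E := hE ▸ integral_nonneg fun v => sq_nonneg v
  have hs : 2 < min r 4 := lt_min hr (by norm_num)
  have hs4 : min r 4 ≤ 4 := min_le_right _ _
  obtain ⟨hint', hK⟩ := integrable_abs_rpow_of_le (by linarith) (min_le_left r 4) hint
  set M := ∫ v, |v| ^ r ∂(f : Measure ℝ) with hM
  have hM0 : 0 ≤ M := integral_nonneg fun v => by positivity
  have h2 : Integrable (fun v : ℝ => v ^ 2) (f : Measure ℝ) :=
    -- Only the integrability is used, so the sample size is taken to be `1`.
    (integral_abs_avg_sq_sub_le hs hs4 le_rfl hint' hK).1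
  have hW : ∀ N : ℕ, 1 ≤ N →
      W2 (rescaledLaw f E (ζ N) : Measure (Fin N → ℝ)) (tensorPower f N) ^ 2
        ≤ ENNReal.ofReal ((√(M + 1) + 2 * (M + 1)) * (N : ℝ) ^ (-(1 - 2 / min r 4))) :=
    fun N hN => W2_rescaledLaw_sq_le_rpow hs hs4 hN hint' hK hE (hζ N)
  have hB : 0 ≤ √(M + 1) + 2 * (M + 1) := by positivity
  refine ⟨fun N hN => ae_mem_kacSphere_rescaledLaw f hN hE0 (hζ N),
    isChaotic_rescaledLaw hs hs4 hint' hE hsym hζ, fun N hN => ?_, fun h N hN => ?_,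
    fun h N hN => ?_, fun h N hN => ?_⟩
  · refine (W2_rescaledLaw_sq_le f hN hE0 (hζ N)).trans ?_
    rw [← hE]
    exact lintegral_sq_sqrt_sub_le_epsilonN hN h2
  · refine (hW N hN).trans (ENNReal.ofReal_le_ofReal ?_)
    rw [min_eq_right h.le, show (-(1 - 2 / 4) : ℝ) = -(1 / 2) by norm_num]
    gcongr
    linarith
  · refine (hW N (by omega)).trans (ENNReal.ofReal_le_ofReal ?_)
    rw [min_eq_right h.ge, show (-(1 - 2 / 4) : ℝ) = -(1 / 2) by norm_num]
    -- The bound already holds without the logarithm; for `N ≥ 2`, `2 log N ≥ 2 log 2 > 1` lets it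
    -- be inserted.
    have hlog : 1 ≤ 2 * Real.log N := by
      have h1 : Real.log 2 ≤ Real.log N := Real.log_le_log (by norm_num) (by exact_mod_cast hN)
      have := Real.log_two_gt_d9
      linarith
    have hpos : 0 ≤ (√(M + 1) + 2 * (M + 1)) * (N : ℝ) ^ (-(1 / 2) : ℝ) := by positivity
    nlinarith [mul_le_mul_of_nonneg_left hlog hpos]
  · refine (hW N hN).trans (ENNReal.ofReal_le_ofReal ?_)
    rw [min_eq_left h.le]
    gcongr
    linarith
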